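/- **Theorem 4.4.** Let $\bar M(c)$ be an indefinite complex space form with $c\neq 0$: a connected smooth manifold with an indefinite semi-Riemannian metric $\bar g$ and a smooth almost complex structure $\bar J$ such that $\bar J^2=-I$, $\bar g(\bar JX,\bar JY)=\bar g(X,Y)$, $\bar\nabla\bar J=0$ for the Levi-Civita connection $\bar\nabla$ of $\bar g$, and whose holomorphic sectional curvature is constant, equal to $c$. Then $\bar M(c)$ has no totally umbilical proper STCR (screen transversal Cauchy–Riemann) lightlike submanifold. Here the following terms are used, for an immersed submanifold $M$ of $\bar M$ with induced (possibly degenerate) metric $g$; all subbundles are smooth of constant rank. * Put $TM^\perp=\{u\in T\bar M|_M : \bar g(u,v)=0 \text{ for all } v\in TM\}$ and $\mathrm{Rad}(TM)=TM\cap TM^\perp$. $M$ is *lightlike* if $\mathrm{Rad}(TM)$ has constant rank $r\ge 1$. It is equipped with complements $S(TM)$ of $\mathrm{Rad}(TM)$ in $TM$ and $S(TM^\perp)$ of $\mathrm{Rad}(TM)$ in $TM^\perp$, and with a lightlike transversal bundle $ltr(TM)$, that is, a totally null complement of $\mathrm{Rad}(TM)$ in the orthogonal complement of $S(TM^\perp)$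 in $S(TM)^\perp$. Put $tr(TM)=ltr(TM)\perp S(TM^\perp)$, so that $T\bar M|_M=TM\oplus tr(TM)$. The second fundamental form $h(X,Y)$ is the $tr(TM)$-component of $\bar\nabla_XY$, for $X,Y\in\Gamma(TM)$. * $M$ is *totally umbilical* if there is a smooth section $H\in\Gamma(tr(TM))$ with $h(X,Y)=g(X,Y)H$ for all $X,Y\in\Gamma(TM)$. * $M$ is *STCR lightlike* if there are subbundles $D_1,D_2\subset \mathrm{Rad}(TM)$, $D_0,D'\subset S(TM)$, $L_1\subset ltr(TM)$ and $S\subset S(TM^\perp)$, with $D_0$ nondegenerate, such that $$\mathrm{Rad}(TM)=D_1\oplus D_2,\qquad \bar JD_1\subset S(TM),\qquad \bar JD_2\subset S(TM^\perp),$$ $$S(TM)=\{\bar JD_1\oplus D'\}\perp D_0,\qquad \bar JD_0=D_0,\qquad \bar JD'=L_1\perp S.$$ It is *proper* if $D_1$, $D_2$, $D_0$ and $S$ are all different from $\{0\}$. -/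

import Mathlib

open scoped Manifold ContDiff Bundle Topology

noncomputable section

/-! ### Semi-Riemannian metrics and indefinite Kähler manifolds -/

/-- A smooth semi-Riemannian metric on a manifold `N` of dimension `d`: a smooth symmetric
`(0,2)`-tensor field which is nondegenerate at every point. -/
structure SemiRiemannianMetric (d : ℕ) (N : Type*) [TopologicalSpace N]
    [ChartedSpace (EuclideanSpace ℝ (Fin d)) N] [IsManifold (𝓡 d) ∞ N] where
  val (x : N) : TangentSpace (𝓡 d) x →L[ℝ] TangentSpace (𝓡 d) x →L[ℝ] ℝ
  symm (x : N) (u v : TangentSpace (𝓡 d) x) : val x u v = val x v u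
  nondegenerate (x : N) (u : TangentSpace (𝓡 d) x) (hu : ∀ v, val x u v = 0) : u = 0
  contMDiff : ContMDiff (𝓡 d)
    ((𝓡 d).prod 𝓘(ℝ, EuclideanSpace ℝ (Fin d) →L[ℝ] EuclideanSpace ℝ (Fin d) →L[ℝ] ℝ)) ∞
    (fun x ↦ Bundle.TotalSpace.mk'
      (EuclideanSpace ℝ (Fin d) →L[ℝ] EuclideanSpace ℝ (Fin d) →L[ℝ] ℝ)
      (E := fun x : N ↦ TangentSpace (𝓡 d) x →L[ℝ] TangentSpace (𝓡 d) x →L[ℝ] ℝ) x (val x))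

namespace SemiRiemannianMetric

variable {d : ℕ} {N : Type*} [TopologicalSpace N]
  [ChartedSpace (EuclideanSpace ℝ (Fin d)) N] [IsManifold (𝓡 d) ∞ N]

/-- The metric at a point, as a bilinear form on the tangent space. -/
def bilin (g : SemiRiemannianMetric d N) (x : N) : LinearMap.BilinForm ℝ (TangentSpace (𝓡 d) x) :=
  LinearMap.mk₂ ℝ (fun u v ↦ g.val x u v) (by simp) (by simp) (by simp) (by simp)

/-- The orthogonal complement of a subspace of a tangent space. -/
def orth (g : SemiRiemannianMetric d N) {x : N} (W : Submodule ℝ (TangentSpace (𝓡 d) x)) :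
    Submodule ℝ (TangentSpace (𝓡 d) x) :=
  (g.bilin x).orthogonal W

/-- The metric takes both negative and positive values at every point, that is, its index `q`
satisfies `0 < q < d`. -/
def IsIndefinite (g : SemiRiemannianMetric d N) : Prop :=
  ∀ x : N, (∃ u, g.val x u u < 0) ∧ (∃ u, 0 < g.val x u u)

/-- `nabla` is the Levi-Civita connection of `g`: a smooth connection on the tangent bundle which
is torsion-free and satisfies `X g(Y, Z) = g(∇_X Y, Z) + g(Y, ∇_X Z)`.
(Here `nabla Y x u` is `∇_u Y` at `x`.) -/
structure IsLeviCivita (g : SemiRiemannianMetric d N)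
    (nabla : CovariantDerivative (𝓡 d) (EuclideanSpace ℝ (Fin d))
      (TangentSpace (𝓡 d) : N → Type _)) : Prop where
  smooth : CovariantDerivative.ContMDiffCovariantDerivative nabla ∞
  torsion_eq_zero : nabla.torsion = 0
  metric (x : N) (Y Z : Π x : N, TangentSpace (𝓡 d) x)
    (hY : MDifferentiableAt (𝓡 d) (𝓡 d).tangent (fun y ↦ (⟨y, Y y⟩ : TangentBundle (𝓡 d) N)) x)
    (hZ : MDifferentiableAt (𝓡 d) (𝓡 d).tangent (fun y ↦ (⟨y, Z y⟩ : TangentBundle (𝓡 d) N)) x)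
    (u : TangentSpace (𝓡 d) x) :
    mvfderiv (𝓡 d) (fun y ↦ g.val y (Y y) (Z y)) x u
      = g.val x (nabla Y x u) (Z x) + g.val x (Y x) (nabla Z x u)

end SemiRiemannianMetric

/-- An indefinite Kähler structure on `N`: an indefinite semi-Riemannian metric `g`, an almost
complex structure `J` (a smooth `(1,1)`-tensor field with `J² = -1`) for which `g` is Hermitian,
and the Levi-Civita connection `nabla` of `g`, for which `J` is parallel. -/
structure IndefiniteKahler (d : ℕ) (N : Type*) [TopologicalSpace N]
    [ChartedSpace (EuclideanSpace ℝ (Fin d)) N] [IsManifold (𝓡 d) ∞ N] where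
  g : SemiRiemannianMetric d N
  indefinite : g.IsIndefinite
  J (x : N) : TangentSpace (𝓡 d) x →L[ℝ] TangentSpace (𝓡 d) x
  contMDiff_J : ContMDiff (𝓡 d)
    ((𝓡 d).prod 𝓘(ℝ, EuclideanSpace ℝ (Fin d) →L[ℝ] EuclideanSpace ℝ (Fin d))) ∞
    (fun x ↦ Bundle.TotalSpace.mk' (EuclideanSpace ℝ (Fin d) →L[ℝ] EuclideanSpace ℝ (Fin d))
      (E := fun x : N ↦ TangentSpace (𝓡 d) x →L[ℝ] TangentSpace (𝓡 d) x) x (J x))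
  J_sq (x : N) (u : TangentSpace (𝓡 d) x) : J x (J x u) = -u
  hermitian (x : N) (u v : TangentSpace (𝓡 d) x) : g.val x (J x u) (J x v) = g.val x u v
  nabla : CovariantDerivative (𝓡 d) (EuclideanSpace ℝ (Fin d)) (TangentSpace (𝓡 d) : N → Type _)
  leviCivita : g.IsLeviCivita nabla
  parallel (x : N) (Y : Π x : N, TangentSpace (𝓡 d) x)
    (hY : MDifferentiableAt (𝓡 d) (𝓡 d).tangent (fun y ↦ (⟨y, Y y⟩ : TangentBundle (𝓡 d) N)) x)
    (u : TangentSpace (𝓡 d) x) :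
    nabla (fun y ↦ J y (Y y)) x u = J x (nabla Y x u)

namespace IndefiniteKahler

variable {d : ℕ} {N : Type*} [TopologicalSpace N]
  [ChartedSpace (EuclideanSpace ℝ (Fin d)) N] [IsManifold (𝓡 d) ∞ N]

/-- The curvature `R(X,Y)Z = ∇_X ∇_Y Z - ∇_Y ∇_X Z - ∇_[X,Y] Z`. -/
def curvature (K : IndefiniteKahler d N) (X Y Z : Π x : N, TangentSpace (𝓡 d) x) (x : N) :
    TangentSpace (𝓡 d) x :=
  K.nabla (fun y ↦ K.nabla Z y (Y y)) x (X x) - K.nabla (fun y ↦ K.nabla Z y (X y)) x (Y x)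
    - K.nabla Z x (VectorField.mlieBracket (𝓡 d) X Y x)

/-- The holomorphic sectional curvature of the plane spanned by `X` and `JX` at `x`, where `X` is
a vector field with `g(X,X) ≠ 0` at `x`. -/
def holomorphicSectionalCurvature (K : IndefiniteKahler d N) (X : Π x : N, TangentSpace (𝓡 d) x)
    (x : N) : ℝ :=
  K.g.val x (K.curvature X (fun y ↦ K.J y (X y)) (fun y ↦ K.J y (X y)) x) (X x)
    / (K.g.val x (X x) (X x)) ^ 2

/-- Constant holomorphic sectional curvature `c`. Together with connectedness of the manifold, this
says that `N` is an indefinite complex space form `N(c)`. -/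
def HasConstantHolomorphicSectionalCurvature (K : IndefiniteKahler d N) (c : ℝ) : Prop :=
  ∀ (x : N) (X : Π x : N, TangentSpace (𝓡 d) x),
    ContMDiffAt (𝓡 d) (𝓡 d).tangent ∞ (fun y ↦ (⟨y, X y⟩ : TangentBundle (𝓡 d) N)) x →
    K.g.val x (X x) (X x) ≠ 0 → K.holomorphicSectionalCurvature X x = c

end IndefiniteKahler

/-! ### Vector fields, subbundles and derivatives along a map -/

section Along

variable {d m : ℕ} {N : Type*} [TopologicalSpace N]
  [ChartedSpace (EuclideanSpace ℝ (Fin d)) N] [IsManifold (𝓡 d) ∞ N]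
  {M : Type*} [TopologicalSpace M] [ChartedSpace (EuclideanSpace ℝ (Fin m)) M]

/-- A smooth subbundle (of constant rank) of the pullback `f^*TN` of the tangent bundle. -/
structure SubbundleAlong (m : ℕ) {M : Type*} [TopologicalSpace M]
    [ChartedSpace (EuclideanSpace ℝ (Fin m)) M] (f : M → N) where
  fiber (p : M) : Submodule ℝ (TangentSpace (𝓡 d) (f p))
  rank : ℕ
  exists_localFrame (p : M) : ∃ U : Set M, IsOpen U ∧ p ∈ U ∧
    ∃ s : Fin rank → Π q : M, TangentSpace (𝓡 d) (f q),
      (∀ i, ContMDiffOn (𝓡 m) (𝓡 d).tangent ∞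
        (fun q ↦ (⟨f q, s i q⟩ : TangentBundle (𝓡 d) N)) U) ∧
      ∀ q ∈ U, LinearIndependent ℝ (fun i ↦ s i q) ∧
        Submodule.span ℝ (Set.range fun i ↦ s i q) = fiber q

/-- A subbundle is nonzero. (As the rank is constant, one nonzero fibre is enough.) -/
def SubbundleAlong.IsNonzero {f : M → N} (D : SubbundleAlong (d := d) m f) : Prop :=
  ∃ p, D.fiber p ≠ ⊥

/-- The derivative `∇_u W` of a vector field `W` along `f : M → N` in the direction of a tangent
vector `u` of `M` at `p`, for a connection `nabla` on `TN`. In a local frame `e_i` of `TN`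
around `f p`, if `W = ∑ i, W^i e_i`, then `∇_u W = ∑ i, (u(W^i) e_i + W^i ∇_{df(u)} e_i)`. -/
def covariantDerivAlong
    (nabla : CovariantDerivative (𝓡 d) (EuclideanSpace ℝ (Fin d))
      (TangentSpace (𝓡 d) : N → Type _))
    (f : M → N) (W : Π q : M, TangentSpace (𝓡 d) (f q)) (p : M) (u : TangentSpace (𝓡 m) p) :
    TangentSpace (𝓡 d) (f p) :=
  let t := trivializationAt (EuclideanSpace ℝ (Fin d)) (TangentSpace (𝓡 d) : N → Type _) (f p)
  let b := (EuclideanSpace.basisFun (Fin d) ℝ).toBasis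
  ∑ i, (mvfderiv (𝓡 m) (fun q ↦ t.localFrameCoeff (𝓡 d) b i (f q) (W q)) p u • t.localFrame b i (f p)
    + t.localFrameCoeff (𝓡 d) b i (f p) (W p) •
      nabla (t.localFrame b i) (f p) (mfderiv (𝓡 m) (𝓡 d) f p u))

/-- The tangent space `T_p M`, as a subspace of `T_{f p} N`. -/
def tangentAlong (f : M → N) (p : M) : Submodule ℝ (TangentSpace (𝓡 d) (f p)) :=
  LinearMap.range (mfderiv (𝓡 m) (𝓡 d) f p : TangentSpace (𝓡 m) p →ₗ[ℝ] TangentSpace (𝓡 d) (f p))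

/-- The fibre `T_p M^⊥` of the normal bundle. -/
def normalAlong (g : SemiRiemannianMetric d N) (f : M → N) (p : M) :
    Submodule ℝ (TangentSpace (𝓡 d) (f p)) :=
  g.orth (tangentAlong (m := m) f p)

/-- The fibre of the radical distribution `Rad(TM) = TM ∩ TM^⊥`. -/
def radicalAlong (g : SemiRiemannianMetric d N) (f : M → N) (p : M) :
    Submodule ℝ (TangentSpace (𝓡 d) (f p)) :=
  tangentAlong (m := m) f p ⊓ normalAlong (m := m) g f p

end Along

/-! ### Lightlike submanifolds -/

/-- A lightlike submanifold `(M, g, S(TM), S(TM^⊥))` of a semi-Riemannian manifold `N`, given by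
an immersion `f`, together with a lightlike transversal bundle `ltr(TM)`. -/
structure LightlikeSubmanifold {d : ℕ} (m : ℕ) {N : Type*} [TopologicalSpace N]
    [ChartedSpace (EuclideanSpace ℝ (Fin d)) N] [IsManifold (𝓡 d) ∞ N]
    {M : Type*} [TopologicalSpace M] [ChartedSpace (EuclideanSpace ℝ (Fin m)) M]
    (g : SemiRiemannianMetric d N) (f : M → N) where
  isImmersion : Manifold.IsImmersion (𝓡 m) (𝓡 d) ∞ f
  /-- The rank `r` of the radical distribution. -/
  r : ℕ
  one_le_r : 1 ≤ r
  finrank_radical (p : M) : Module.finrank ℝ (radicalAlong (m := m) g f p) = r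
  /-- The screen distribution `S(TM)`, a complement of `Rad(TM)` in `TM`. -/
  screen : SubbundleAlong (d := d) m f
  screen_disjoint (p : M) : Disjoint (screen.fiber p) (radicalAlong (m := m) g f p)
  screen_sup (p : M) :
    screen.fiber p ⊔ radicalAlong (m := m) g f p = tangentAlong (m := m) f p
  /-- The screen transversal bundle `S(TM^⊥)`, a complement of `Rad(TM)` in `TM^⊥`. -/
  coscreen : SubbundleAlong (d := d) m f
  coscreen_disjoint (p : M) : Disjoint (coscreen.fiber p) (radicalAlong (m := m) g f p)
  coscreen_sup (p : M) :
    coscreen.fiber p ⊔ radicalAlong (m := m) g f p = normalAlong (m := m) g f p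
  /-- The lightlike transversal bundle `ltr(TM)`: a totally null complement of `Rad(TM)` in
  the orthogonal complement of `S(TM^⊥)` in `S(TM)^⊥`. -/
  ltr : SubbundleAlong (d := d) m f
  ltr_null (p : M) (u v : TangentSpace (𝓡 d) (f p)) (hu : u ∈ ltr.fiber p) (hv : v ∈ ltr.fiber p) :
    g.val (f p) u v = 0
  ltr_disjoint (p : M) : Disjoint (radicalAlong (m := m) g f p) (ltr.fiber p)
  ltr_sup (p : M) : radicalAlong (m := m) g f p ⊔ ltr.fiber p
    = g.orth (screen.fiber p) ⊓ g.orth (coscreen.fiber p)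

namespace LightlikeSubmanifold

variable {d m : ℕ} {N : Type*} [TopologicalSpace N]
  [ChartedSpace (EuclideanSpace ℝ (Fin d)) N] [IsManifold (𝓡 d) ∞ N]
  {M : Type*} [TopologicalSpace M] [ChartedSpace (EuclideanSpace ℝ (Fin m)) M]
  {g : SemiRiemannianMetric d N} {f : M → N}

/-- The fibre of the transversal bundle `tr(TM) = ltr(TM) ⊥ S(TM^⊥)`. -/
def tr (L : LightlikeSubmanifold m g f) (p : M) : Submodule ℝ (TangentSpace (𝓡 d) (f p)) :=
  L.ltr.fiber p ⊔ L.coscreen.fiber p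

/-- The decomposition `TN|_M = TM ⊕ tr(TM)`. -/
theorem isCompl_tangent_tr (L : LightlikeSubmanifold m g f) (p : M) :
    IsCompl (tangentAlong (m := m) f p) (L.tr p) := by
  have : FiniteDimensional ℝ (TangentSpace (𝓡 d) (f p)) :=
    inferInstanceAs (FiniteDimensional ℝ (EuclideanSpace ℝ (Fin d)))
  have hrefl : (g.bilin (f p)).IsRefl := fun u v h ↦ (g.symm (f p) v u).trans h
  have hnormal : normalAlong (m := m) g f p = g.orth (tangentAlong (m := m) f p) := rfl
  have hscreen : L.screen.fiber p ≤ tangentAlong (m := m) f p :=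
    le_sup_left.trans (L.screen_sup p).le
  have hcoscreen : L.coscreen.fiber p ≤ normalAlong (m := m) g f p :=
    le_sup_left.trans (L.coscreen_sup p).le
  have hltr : L.ltr.fiber p ≤ g.orth (L.screen.fiber p) ⊓ g.orth (L.coscreen.fiber p) :=
    le_sup_right.trans (L.ltr_sup p).le
  have hrad : radicalAlong (m := m) g f p ≤ g.orth (L.screen.fiber p) ⊓ g.orth (L.coscreen.fiber p) :=
    le_sup_left.trans (L.ltr_sup p).le
  have mem_orth : ∀ (W : Submodule ℝ (TangentSpace (𝓡 d) (f p))) (u : TangentSpace (𝓡 d) (f p)),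
      u ∈ g.orth W ↔ ∀ w ∈ W, g.val (f p) w u = 0 := fun W u ↦ Iff.rfl
  have hnd : Disjoint (L.screen.fiber p ⊔ L.coscreen.fiber p)
      (g.orth (L.screen.fiber p ⊔ L.coscreen.fiber p)) := by
    rw [Submodule.disjoint_def]
    intro x hx hx'
    obtain ⟨s, hs, t, ht, rfl⟩ := Submodule.mem_sup.1 hx
    rw [mem_orth] at hx'
    have h1 : ∀ w ∈ L.screen.fiber p, g.val (f p) w s = 0 := fun w hw ↦ by
      have h := hx' w (le_sup_left (a := L.screen.fiber p) hw)
      rwa [map_add, (mem_orth _ _).1 (hcoscreen ht) w (hscreen hw), add_zero] at h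
    have h2 : ∀ w ∈ L.coscreen.fiber p, g.val (f p) w t = 0 := fun w hw ↦ by
      have h := hx' w (le_sup_right (a := L.screen.fiber p) hw)
      rwa [map_add, g.symm (f p) w s, (mem_orth _ _).1 (hcoscreen hw) s (hscreen hs), zero_add] at h
    have hsr : s ∈ radicalAlong (m := m) g f p := by
      refine ⟨hscreen hs, (mem_orth _ _).2 fun w hw ↦ ?_⟩
      rw [← L.screen_sup p] at hw
      obtain ⟨a, ha, b, hb, rfl⟩ := Submodule.mem_sup.1 hw
      rw [map_add, add_apply, h1 a ha, g.symm (f p) b s,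
        (mem_orth _ _).1 (hrad hb).1 s hs, add_zero]
    have hs0 : s = 0 := Submodule.disjoint_def.1 (L.screen_disjoint p) s hs hsr
    have htr : t ∈ g.orth (g.orth (tangentAlong (m := m) f p)) := by
      refine (mem_orth _ _).2 fun w hw ↦ ?_
      rw [← hnormal, ← L.coscreen_sup p] at hw
      obtain ⟨a, ha, b, hb, rfl⟩ := Submodule.mem_sup.1 hw
      rw [map_add, add_apply, h2 a ha, g.symm (f p) b t,
        (mem_orth _ _).1 (hrad hb).2 t ht, add_zero]
    have hB : (g.bilin (f p)).Nondegenerate :=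
      ⟨fun u hu ↦ g.nondegenerate (f p) u hu,
        fun u hu ↦ g.nondegenerate (f p) u fun v ↦ (g.symm (f p) u v).trans (hu v)⟩
    have htt : t ∈ radicalAlong (m := m) g f p := by
      refine ⟨?_, hcoscreen ht⟩
      have := LinearMap.BilinForm.orthogonal_orthogonal hB hrefl (tangentAlong (m := m) f p)
      rw [← this]
      exact htr
    have ht0 : t = 0 := Submodule.disjoint_def.1 (L.coscreen_disjoint p) t ht htt
    rw [hs0, ht0, add_zero]
  have htop := ((LinearMap.BilinForm.isCompl_orthogonal_iff_disjoint hrefl).2 hnd).sup_eq_top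
  have horth : g.orth (L.screen.fiber p ⊔ L.coscreen.fiber p)
      ≤ radicalAlong (m := m) g f p ⊔ L.ltr.fiber p := by
    rw [L.ltr_sup p]
    exact fun x hx ↦ ⟨fun w hw ↦ hx w (le_sup_left (a := L.screen.fiber p) hw),
      fun w hw ↦ hx w (le_sup_right (a := L.screen.fiber p) hw)⟩
  constructor
  · rw [Submodule.disjoint_def]
    intro x hx hx'
    obtain ⟨l, hl, s, hs, rfl⟩ := Submodule.mem_sup.1 hx'
    have hl0 : l = 0 := by
      refine g.nondegenerate (f p) l fun v ↦ ?_
      have hv : v ∈ (L.screen.fiber p ⊔ L.coscreen.fiber p)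
          ⊔ (g.bilin (f p)).orthogonal (L.screen.fiber p ⊔ L.coscreen.fiber p) := htop ▸ trivial
      obtain ⟨a, ha, b, hb, rfl⟩ := Submodule.mem_sup.1 hv
      obtain ⟨a₁, ha₁, a₂, ha₂, rfl⟩ := Submodule.mem_sup.1 ha
      obtain ⟨b₁, hb₁, b₂, hb₂, rfl⟩ := Submodule.mem_sup.1 (horth hb)
      have e1 : g.val (f p) l a₁ = 0 := (g.symm _ _ _).trans ((mem_orth _ _).1 (hltr hl).1 a₁ ha₁)
      have e2 : g.val (f p) l a₂ = 0 := (g.symm _ _ _).trans ((mem_orth _ _).1 (hltr hl).2 a₂ ha₂)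
      have e3 : g.val (f p) l b₁ = 0 := by
        have h := (mem_orth _ _).1 hb₁.2 (l + s) hx
        rw [map_add, add_apply, (mem_orth _ _).1 (hrad hb₁).2 s hs,
          add_zero] at h
        exact h
      have e4 : g.val (f p) l b₂ = 0 := L.ltr_null p l b₂ hl hb₂
      rw [map_add, map_add, map_add, e1, e2, e3, e4]
      simp
    subst hl0
    rw [zero_add] at hx ⊢
    exact Submodule.disjoint_def.1 (L.coscreen_disjoint p) s hs ⟨hx, hcoscreen hs⟩
  · rw [codisjoint_iff, eq_top_iff, ← htop]
    have h1 : radicalAlong (m := m) g f p ≤ tangentAlong (m := m) f p := inf_le_left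
    have h2 : L.ltr.fiber p ≤ L.tr p := le_sup_left
    have h3 : L.coscreen.fiber p ≤ L.tr p := le_sup_right
    exact sup_le (sup_le_sup hscreen h3) (horth.trans (sup_le_sup h1 h2))

/-- The second fundamental form `h(X,Y)`: the transversal part of `∇_X Y` in the decomposition
`TN|_M = TM ⊕ tr(TM)` (Gauss formula). -/
def secondFundamentalForm (L : LightlikeSubmanifold m g f)
    (nabla : CovariantDerivative (𝓡 d) (EuclideanSpace ℝ (Fin d))
      (TangentSpace (𝓡 d) : N → Type _))
    (X Y : Π p : M, TangentSpace (𝓡 m) p) (p : M) : TangentSpace (𝓡 d) (f p) :=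
  Submodule.projection _ _ (L.isCompl_tangent_tr p).symm
    (covariantDerivAlong nabla f (fun q ↦ mfderiv (𝓡 m) (𝓡 d) f q (Y q)) p (X p))

/-- `M` is totally umbilical: there is a smooth transversal vector field `H` with
`h(X,Y) = g(X,Y) H` for all smooth vector fields `X`, `Y` tangent to `M`. -/
def IsTotallyUmbilical [IsManifold (𝓡 m) ∞ M] (L : LightlikeSubmanifold m g f)
    (nabla : CovariantDerivative (𝓡 d) (EuclideanSpace ℝ (Fin d))
      (TangentSpace (𝓡 d) : N → Type _)) : Prop :=
  ∃ H : Π p : M, TangentSpace (𝓡 d) (f p),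
    (∀ p, H p ∈ L.tr p) ∧
    ContMDiff (𝓡 m) (𝓡 d).tangent ∞ (fun p ↦ (⟨f p, H p⟩ : TangentBundle (𝓡 d) N)) ∧
    ∀ X Y : Π p : M, TangentSpace (𝓡 m) p,
      ContMDiff (𝓡 m) (𝓡 m).tangent ∞ (fun p ↦ (⟨p, X p⟩ : TangentBundle (𝓡 m) M)) →
      ContMDiff (𝓡 m) (𝓡 m).tangent ∞ (fun p ↦ (⟨p, Y p⟩ : TangentBundle (𝓡 m) M)) →
      ∀ p, L.secondFundamentalForm nabla X Y p
        = g.val (f p) (mfderiv (𝓡 m) (𝓡 d) f p (X p)) (mfderiv (𝓡 m) (𝓡 d) f p (Y p)) • H p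

end LightlikeSubmanifold

/-! ### Screen transversal Cauchy-Riemann lightlike submanifolds -/

section STCR

variable {d m : ℕ} {N : Type*} [TopologicalSpace N]
  [ChartedSpace (EuclideanSpace ℝ (Fin d)) N] [IsManifold (𝓡 d) ∞ N]
  {M : Type*} [TopologicalSpace M] [ChartedSpace (EuclideanSpace ℝ (Fin m)) M]

/-- The image `J(D_p)` of the fibre at `p` of a subbundle along `f`. -/
def IndefiniteKahler.mapJ (K : IndefiniteKahler d N) {f : M → N}
    (D : SubbundleAlong (d := d) m f) (p : M) : Submodule ℝ (TangentSpace (𝓡 d) (f p)) :=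
  (D.fiber p).map (K.J (f p) : TangentSpace (𝓡 d) (f p) →ₗ[ℝ] TangentSpace (𝓡 d) (f p))

/-- The subbundles that make `M` a screen transversal Cauchy-Riemann (STCR) lightlike submanifold:
`Rad(TM) = D₁ ⊕ D₂` with `J D₁ ⊆ S(TM)`, `J D₂ ⊆ S(TM^⊥)`, and
`S(TM) = (J D₁ ⊕ D') ⊥ D₀` with `D₀` nondegenerate, `J D₀ = D₀`, `J D' = L₁ ⊥ S`,
`L₁ ⊆ ltr(TM)`, `S ⊆ S(TM^⊥)`. -/
structure STCRDecomposition (K : IndefiniteKahler d N) {f : M → N}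
    (L : LightlikeSubmanifold m K.g f) where
  D₁ : SubbundleAlong (d := d) m f
  D₂ : SubbundleAlong (d := d) m f
  D₀ : SubbundleAlong (d := d) m f
  D' : SubbundleAlong (d := d) m f
  L₁ : SubbundleAlong (d := d) m f
  S : SubbundleAlong (d := d) m f
  rad_sup (p : M) : D₁.fiber p ⊔ D₂.fiber p = radicalAlong (m := m) K.g f p
  rad_disjoint (p : M) : Disjoint (D₁.fiber p) (D₂.fiber p)
  J_D₁_le (p : M) : K.mapJ D₁ p ≤ L.screen.fiber p
  J_D₂_le (p : M) : K.mapJ D₂ p ≤ L.coscreen.fiber p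
  screen_sup (p : M) : (K.mapJ D₁ p ⊔ D'.fiber p) ⊔ D₀.fiber p = L.screen.fiber p
  J_D₁_disjoint (p : M) : Disjoint (K.mapJ D₁ p) (D'.fiber p)
  D₀_disjoint (p : M) : Disjoint (K.mapJ D₁ p ⊔ D'.fiber p) (D₀.fiber p)
  D₀_orth (p : M) : D₀.fiber p ≤ K.g.orth (K.mapJ D₁ p ⊔ D'.fiber p)
  D₀_nondegenerate (p : M) : Disjoint (D₀.fiber p) (K.g.orth (D₀.fiber p))
  J_D₀ (p : M) : K.mapJ D₀ p = D₀.fiber p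
  L₁_le (p : M) : L₁.fiber p ≤ L.ltr.fiber p
  S_le (p : M) : S.fiber p ≤ L.coscreen.fiber p
  J_D' (p : M) : K.mapJ D' p = L₁.fiber p ⊔ S.fiber p
  L₁_disjoint (p : M) : Disjoint (L₁.fiber p) (S.fiber p)
  L₁_orth (p : M) : L₁.fiber p ≤ K.g.orth (S.fiber p)

/-- `M` is a proper STCR lightlike submanifold: `D₁`, `D₂`, `D₀` and `S` are nonzero. -/
def LightlikeSubmanifold.IsProperSTCR (K : IndefiniteKahler d N) {f : M → N}
    (L : LightlikeSubmanifold m K.g f) : Prop :=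
  ∃ D : STCRDecomposition K L,
    D.D₁.IsNonzero ∧ D.D₂.IsNonzero ∧ D.D₀.IsNonzero ∧ D.S.IsNonzero

end STCR

end

/-! Take a non-null `X` in `D₀` and a nonzero `ξ` in `D₂`, and compute `R(X, JX)ξ` in two ways. In a
space of constant holomorphic curvature `c`, `R(X, JX)JY = (c/2)(g(X,Y)X - g(X,JY)JX + g(X,X)Y)`.
With `JY = ξ` the first two terms vanish, since `ξ` is orthogonal to `X` and `JX`; hence `R(X, JX)ξ
= -(c/2) g(X,X) Jξ`, a nonzero multiple of a vector of `S(TM^⊥)`, and so not tangent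
(`curvatureForm_complex_line`). If `M` is totally umbilical, however, `R(X, Y)ξ` is tangent for all
tangent `X`, `Y` and radical `ξ`: modulo `TM`, `∇_X ∇_Y ξ` is `-g(X,Y) g(H,ξ) H`, which is symmetric
in `X` and `Y` (`curvatureOperator_mem_tangentAlong`).

The curvature identities are proved for the real vector space of global smooth vector fields,
evaluated at a point. The algebraic lemma `kahlerCurvature_apply_complex_line` needs only real
multilinearity, so tensoriality of `R` is never proved separately. Fields along `f` are likewise
replaced by ambient fields that agree with them near a point of `M`. -/

noncomputable section

/-! ### Calculus of global smooth vector fields. -/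

/-- Smooth vector fields on a manifold. -/
abbrev SmoothVectorField (d : ℕ) (N : Type*) [TopologicalSpace N]
    [ChartedSpace (EuclideanSpace ℝ (Fin d)) N] [IsManifold (𝓡 d) ∞ N] :=
  ContMDiffSection (𝓡 d) (EuclideanSpace ℝ (Fin d)) ∞ (TangentSpace (𝓡 d) : N → Type _)

namespace IndefiniteKahler

variable {d : ℕ} {N : Type*} [TopologicalSpace N]
  [ChartedSpace (EuclideanSpace ℝ (Fin d)) N] [IsManifold (𝓡 d) ∞ N]

theorem _root_.SmoothVectorField.mdifferentiableAt (X : SmoothVectorField d N) (x : N) :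
    MDifferentiableAt (𝓡 d) (𝓡 d).tangent (fun y ↦ (⟨y, X y⟩ : TangentBundle (𝓡 d) N)) x :=
  (X.contMDiff x).mdifferentiableAt (by simp)

/-- The product of a smooth function and a smooth vector field. -/
def _root_.SmoothVectorField.mulFun (φ : N → ℝ) (hφ : ContMDiff (𝓡 d) 𝓘(ℝ) ∞ φ)
    (X : SmoothVectorField d N) : SmoothVectorField d N :=
  ⟨φ • ⇑X, hφ.smul_section X.contMDiff⟩

@[simp]
theorem _root_.SmoothVectorField.mulFun_apply (φ : N → ℝ) (hφ : ContMDiff (𝓡 d) 𝓘(ℝ) ∞ φ)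
    (X : SmoothVectorField d N) (x : N) : X.mulFun φ hφ x = φ x • X x := rfl

/-- The covariant derivative `∇_X Y` of smooth vector fields. -/
def cov (K : IndefiniteKahler d N) :
    SmoothVectorField d N →ₗ[ℝ] SmoothVectorField d N →ₗ[ℝ] SmoothVectorField d N :=
  LinearMap.mk₂ ℝ
    (fun X Y ↦ ⟨fun x ↦ K.nabla Y x (X x), by
      have h := K.leviCivita.smooth.contMDiff.contMDiff (σ := ⇑Y) Y.contMDiff.contMDiffOn
      exact (contMDiffOn_univ.1 h).clm_bundle_apply X.contMDiff⟩)
    (fun X X' Y ↦ by ext x; simp) (fun a X Y ↦ by ext x; simp)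
    (fun X Y Y' ↦ by
      ext x
      have := K.nabla.isCovariantDerivativeOnUniv.add (Y.mdifferentiableAt x)
        (Y'.mdifferentiableAt x)
      simp [this])
    (fun a X Y ↦ by
      ext x
      have := K.nabla.isCovariantDerivativeOnUniv.smul_const a (Y.mdifferentiableAt x)
      simp [this])

@[simp]
theorem cov_apply (K : IndefiniteKahler d N) (X Y : SmoothVectorField d N) (x : N) :
    K.cov X Y x = K.nabla Y x (X x) := rfl

/-- The almost complex structure, acting on smooth vector fields. -/
def complexStructure (K : IndefiniteKahler d N) :
    SmoothVectorField d N →ₗ[ℝ] SmoothVectorField d N where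
  toFun X := ⟨fun x ↦ K.J x (X x), K.contMDiff_J.clm_bundle_apply X.contMDiff⟩
  map_add' X Y := by ext x; simp
  map_smul' a X := by ext x; simp

@[simp]
theorem complexStructure_apply (K : IndefiniteKahler d N) (X : SmoothVectorField d N) (x : N) :
    K.complexStructure X x = K.J x (X x) := rfl

theorem complexStructure_complexStructure (K : IndefiniteKahler d N) (X : SmoothVectorField d N) :
    K.complexStructure (K.complexStructure X) = -X := by
  ext x; simp [K.J_sq]

theorem contMDiff_metric (K : IndefiniteKahler d N) (X Y : SmoothVectorField d N) :
    ContMDiff (𝓡 d) 𝓘(ℝ) ∞ (fun x ↦ K.g.val x (X x) (Y x)) := by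
  intro x
  have h := K.g.contMDiff.clm_bundle_apply₂ (F₃ := ℝ) (E₃ := Bundle.Trivial N ℝ)
    X.contMDiff Y.contMDiff x
  rw [Bundle.contMDiffAt_totalSpace] at h
  exact h.2

/-- The Lie bracket of smooth vector fields, expressed by the torsion-free connection. -/
def bracket (K : IndefiniteKahler d N) (X Y : SmoothVectorField d N) : SmoothVectorField d N :=
  K.cov X Y - K.cov Y X

theorem bracket_apply (K : IndefiniteKahler d N) (X Y : SmoothVectorField d N) (x : N) :
    K.bracket X Y x = VectorField.mlieBracket (𝓡 d) X Y x :=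
  (CovariantDerivative.torsion_eq_zero_iff _).1 K.leviCivita.torsion_eq_zero
    (X.mdifferentiableAt x) (Y.mdifferentiableAt x)

theorem coe_bracket (K : IndefiniteKahler d N) (X Y : SmoothVectorField d N) :
    ⇑(K.bracket X Y) = VectorField.mlieBracket (𝓡 d) X Y := funext (K.bracket_apply X Y)

/-- This is the Jacobi identity of the Lie bracket, carried over by `coe_bracket`. It yields both
the commutator formula for derivatives of functions and the first Bianchi identity. -/
theorem bracket_bracket (K : IndefiniteKahler d N) (X Y Z : SmoothVectorField d N) :
    K.bracket X (K.bracket Y Z) = K.bracket (K.bracket X Y) Z + K.bracket Y (K.bracket X Z) := by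
  have : IsManifold (𝓡 d) (minSmoothness ℝ 3) N := by
    simp only [minSmoothness_of_isRCLikeNormedField]
    exact IsManifold.of_le (n := ∞) (WithTop.coe_le_coe.2 (le_top : (3 : ℕ∞) ≤ ⊤))
  have h2 (V : SmoothVectorField d N) (x : N) : ContMDiffAt (𝓡 d) (𝓡 d).tangent
      (minSmoothness ℝ 2) (fun y ↦ (⟨y, V y⟩ : TangentBundle (𝓡 d) N)) x := by
    simp only [minSmoothness_of_isRCLikeNormedField]
    exact (V.contMDiff x).of_le (WithTop.coe_le_coe.2 (le_top : (2 : ℕ∞) ≤ ⊤))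
  ext x
  simp only [ContMDiffSection.coe_add, Pi.add_apply, coe_bracket]
  exact VectorField.leibniz_identity_mlieBracket_apply (h2 X x) (h2 Y x) (h2 Z x)

/-- The derivative of a smooth function along a smooth vector field. -/
theorem _root_.SmoothVectorField.contMDiff_mvfderiv (X : SmoothVectorField d N) {φ : N → ℝ}
    (hφ : ContMDiff (𝓡 d) 𝓘(ℝ) ∞ φ) :
    ContMDiff (𝓡 d) 𝓘(ℝ) ∞ (fun x ↦ mvfderiv (𝓡 d) φ x (X x)) := by
  have h := (hφ.contMDiff_tangentMap (m := ∞) le_rfl).comp X.contMDiff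
  exact (contMDiff_snd_tangentBundle_modelSpace ℝ 𝓘(ℝ)).comp h

theorem bracket_mulFun (K : IndefiniteKahler d N) (X Y : SmoothVectorField d N) {φ : N → ℝ}
    (hφ : ContMDiff (𝓡 d) 𝓘(ℝ) ∞ φ) :
    K.bracket X (Y.mulFun φ hφ) =
      Y.mulFun _ (X.contMDiff_mvfderiv hφ) + (K.bracket X Y).mulFun φ hφ := by
  ext x
  simp only [ContMDiffSection.coe_add, Pi.add_apply, SmoothVectorField.mulFun_apply]
  simp only [coe_bracket]
  exact VectorField.mlieBracket_smul_right ((hφ x).mdifferentiableAt (by simp))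
    (Y.mdifferentiableAt x)

/-- Cutting off with a bump function globalises a local field without changing it near `x`. -/
theorem _root_.SmoothVectorField.exists_eventuallyEq [T2Space N] {x : N} {u : Set N}
    (hu : IsOpen u) (hx : x ∈ u) {s : Π y : N, TangentSpace (𝓡 d) y}
    (hs : ContMDiffOn (𝓡 d) (𝓡 d).tangent ∞ (fun y ↦ (⟨y, s y⟩ : TangentBundle (𝓡 d) N)) u) :
    ∃ X : SmoothVectorField d N, ∀ᶠ y in 𝓝 x, X y = s y := by
  obtain ⟨ψ, -, hψ⟩ := (SmoothBumpFunction.nhds_basis_tsupport (I := 𝓡 d) x).mem_iff.1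
    (hu.mem_nhds hx)
  refine ⟨⟨(ψ : N → ℝ) • s, 
    ContMDiffOn.smul_section_of_tsupport ψ.contMDiff.contMDiffOn hu hψ hs⟩, ?_⟩
  filter_upwards [ψ.eventuallyEq_one] with y hy
  simp [hy]

theorem _root_.SmoothVectorField.exists_eq [T2Space N] {x : N} (v : TangentSpace (𝓡 d) x) :
    ∃ X : SmoothVectorField d N, X x = v := by
  let t := trivializationAt (EuclideanSpace ℝ (Fin d)) (TangentSpace (𝓡 d) : N → Type _) x
  let b := (EuclideanSpace.basisFun (Fin d) ℝ).toBasis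
  have hx : x ∈ t.baseSet := FiberBundle.mem_baseSet_trivializationAt' x
  obtain ⟨X, hX⟩ := SmoothVectorField.exists_eventuallyEq t.open_baseSet hx
    (s := fun y ↦ ∑ i, (t.basisAt b hx).repr v i • t.localFrame b i y)
    (ContMDiffOn.sum_section fun i _ ↦
      (t.contMDiffOn_localFrame_baseSet ∞ b i).const_smul_section)
  refine ⟨X, hX.self_of_nhds.trans ?_⟩
  conv_rhs => rw [← (t.basisAt b hx).sum_repr v]
  exact Finset.sum_congr rfl fun i _ ↦ by rw [t.localFrame_apply_of_mem_baseSet b hx]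

/-- `[X, Y] φ = X (Y φ) - Y (X φ)`. -/
theorem mvfderiv_bracket [T2Space N] (K : IndefiniteKahler d N) (X Y : SmoothVectorField d N)
    {φ : N → ℝ} (hφ : ContMDiff (𝓡 d) 𝓘(ℝ) ∞ φ) (x : N) :
    mvfderiv (𝓡 d) φ x (K.bracket X Y x) =
      mvfderiv (𝓡 d) (fun y ↦ mvfderiv (𝓡 d) φ y (Y y)) x (X x)
        - mvfderiv (𝓡 d) (fun y ↦ mvfderiv (𝓡 d) φ y (X y)) x (Y x) := by
  -- Indefiniteness serves here to supply a nonzero vector at `x`. The Jacobi identity for `X`, `Y`,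
  -- `φZ`, minus `φ` times that for `X`, `Y`, `Z`, is the claimed identity multiplied by `Z`.
  obtain ⟨v, hv⟩ := (K.indefinite x).2
  obtain ⟨Z, hZ⟩ := SmoothVectorField.exists_eq v
  have hv0 : v ≠ 0 := by rintro rfl; simp at hv
  have key := congrArg (fun V : SmoothVectorField d N ↦ V x)
    (K.bracket_bracket X Y (Z.mulFun φ hφ))
  have hadd : ∀ A B C : SmoothVectorField d N, K.bracket A (B + C) = K.bracket A B + K.bracket A C :=
    fun A B C ↦ by simp only [bracket, map_add, LinearMap.add_apply]; abel
  have hj := congrArg (fun V : SmoothVectorField d N ↦ V x) (K.bracket_bracket X Y Z)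
  simp only [bracket_mulFun, hadd, ContMDiffSection.coe_add, Pi.add_apply,
    SmoothVectorField.mulFun_apply, hZ] at key hj
  rw [hj, smul_add] at key
  refine sub_eq_zero.1 (smul_left_injective ℝ hv0 ?_)
  simp only [sub_smul, zero_smul]
  rw [← sub_eq_zero] at key
  rw [← neg_eq_zero, ← key]
  module

end IndefiniteKahler

/-! ### Algebra of Kähler curvature forms. -/

/-- If a quartic polynomial function vanishes wherever a nonzero quadratic one does not, then its
constant coefficient vanishes. -/
theorem quartic_const_eq_zero {a₀ a₁ a₂ a₃ a₄ b₀ b₁ b₂ : ℝ} (hb : b₂ ≠ 0)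
    (h : ∀ t : ℝ, b₀ + b₁ * t + b₂ * t ^ 2 ≠ 0 →
      a₀ + a₁ * t + a₂ * t ^ 2 + a₃ * t ^ 3 + a₄ * t ^ 4 = 0) : a₀ = 0 := by
  open Polynomial in
  let P : ℝ[X] := C a₀ + C a₁ * X + C a₂ * X ^ 2 + C a₃ * X ^ 3 + C a₄ * X ^ 4
  let Q : ℝ[X] := C b₀ + C b₁ * X + C b₂ * X ^ 2
  -- The product vanishes at every real number, so it is the zero polynomial, and one factor must be
  -- zero.
  have hPQ : P * Q = 0 := by
    refine Polynomial.funext fun t ↦ ?_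
    simp only [P, Q, Polynomial.eval_mul, Polynomial.eval_add, Polynomial.eval_C,
      Polynomial.eval_X, Polynomial.eval_pow, Polynomial.eval_zero]
    by_cases ht : b₀ + b₁ * t + b₂ * t ^ 2 = 0
    · rw [ht, mul_zero]
    · rw [h t ht, zero_mul]
  have hQ : Q ≠ 0 := fun h0 ↦ hb (by
    have := congrArg (fun p ↦ Polynomial.coeff p 2) h0
    simpa [Q, Polynomial.coeff_X, Polynomial.coeff_C] using this)
  have hP := (mul_eq_zero.1 hPQ).resolve_right hQ
  have := congrArg (fun p ↦ Polynomial.eval 0 p) hP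
  simpa [P] using this

section CurvatureAlgebra

variable {V : Type*} [AddCommGroup V] [Module ℝ V]

/-- A quadrilinear form with the symmetries of the curvature tensor of a Kähler manifold and with
constant holomorphic sectional curvature `c`: the values `R(X, JX, JY, W)`. -/
theorem kahlerCurvature_apply_complex_line (g : V →ₗ[ℝ] V →ₗ[ℝ] ℝ) (J : V →ₗ[ℝ] V)
    (R : V →ₗ[ℝ] V →ₗ[ℝ] V →ₗ[ℝ] V →ₗ[ℝ] ℝ) (c : ℝ)
    (g_symm : ∀ X Y, g X Y = g Y X) (g_J : ∀ X Y, g (J X) (J Y) = g X Y)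
    (J_J : ∀ X, J (J X) = -X)
    (R_swap : ∀ X Y Z W, R X Y Z W = -R Y X Z W)
    (R_skew : ∀ X Y Z W, R X Y Z W = -R X Y W Z)
    (bianchi : ∀ X Y Z W, R X Y Z W + R Y Z X W + R Z X Y W = 0)
    (R_J : ∀ X Y Z W, R X Y (J Z) (J W) = R X Y Z W)
    (hol : ∀ X, g X X ≠ 0 → R X (J X) (J X) X = c * g X X ^ 2)
    (nonnull : ∃ X, g X X ≠ 0) (X Y W : V) :
    R X (J X) (J Y) W
      = c / 2 * (g X Y * g X W + g X (J Y) * g X (J W) + g X X * g Y W) := by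
  -- The classical octahedron argument: the four cyclic Bianchi identities combine, after
  -- skew-symmetry, into pair symmetry.
  have R_pair : ∀ X Y Z W, R X Y Z W = R Z W X Y := fun X Y Z W ↦ by
    linarith [bianchi X Y Z W, bianchi Y Z W X, bianchi Z W X Y, bianchi W X Y Z,
      R_swap X Y Z W, R_skew X Y Z W, R_swap Y Z X W, R_skew Y Z X W, R_swap Z X Y W,
      R_skew Z X Y W, R_swap Y Z W X, R_skew Y Z W X, R_swap Z W Y X, R_skew Z W Y X,
      R_swap W Y Z X, R_skew W Y Z X, R_swap Z W X Y, R_skew Z W X Y, R_swap W X Z Y,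
      R_skew W X Z Y, R_swap X Z W Y, R_skew X Z W Y, R_swap W X Y Z, R_skew W X Y Z,
      R_swap X Y W Z, R_skew X Y W Z, R_swap Y W X Z, R_skew Y W X Z]
  have R_J' : ∀ X Y Z W, R (J X) (J Y) Z W = R X Y Z W := fun X Y Z W ↦ by
    rw [R_pair, R_J, R_pair]
  have R_mixed : ∀ X Y Z W, R X Y (J Z) W = R X Y (J W) Z := fun X Y Z W ↦ by
    rw [R_skew, ← R_J, J_J]; simp
  -- The curvature condition extends to null `X` by perturbation: along `X + t • V` with `V`
  -- non-null it is a quartic identity in `t`, valid wherever the quadratic `g(X + tV, X + tV)` is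
  -- nonzero. The `aᵢ` and `bᵢ` are the coefficients of these two polynomials.
  have hol' : ∀ X, R X (J X) (J X) X = c * g X X ^ 2 := fun X ↦ by
    obtain ⟨V, hV⟩ := nonnull
    have key := quartic_const_eq_zero
      (a₀ := R X (J X) (J X) X - c * g X X ^ 2)
      (a₁ := R V (J X) (J X) X + R X (J V) (J X) X + R X (J X) (J V) X + R X (J X) (J X) V
        - c * (2 * g X X * (g X V + g V X)))
      (a₂ := R V (J V) (J X) X + R V (J X) (J V) X + R V (J X) (J X) V + R X (J V) (J V) X
        + R X (J V) (J X) V + R X (J X) (J V) V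
        - c * ((g X V + g V X) ^ 2 + 2 * g X X * g V V))
      (a₃ := R X (J V) (J V) V + R V (J X) (J V) V + R V (J V) (J X) V + R V (J V) (J V) X
        - c * (2 * g V V * (g X V + g V X)))
      (a₄ := R V (J V) (J V) V - c * g V V ^ 2)
      (b₀ := g X X) (b₁ := g X V + g V X) (b₂ := g V V) hV fun t ht ↦ by
        have h := hol (X + t • V) (by
          simp only [map_add, map_smul, LinearMap.add_apply, LinearMap.smul_apply, smul_eq_mul]
          intro h0; apply ht; linear_combination h0)
        simp only [map_add, map_smul, LinearMap.add_apply, LinearMap.smul_apply, smul_eq_mul] at h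
        linear_combination h
    linarith
  have sum_eq : ∀ X Y, R X (J X) (J Y) Y + 2 * R X (J Y) (J Y) X
      = c * (2 * g X Y ^ 2 + g X X * g Y Y) := fun X Y ↦ by
    -- Polarisation: the values at `X + Y` and `X - Y`, less those at `X` and `Y`, isolate the part
    -- of degree two in each variable. By `e1`–`e4` its six curvature terms reduce to two copies of
    -- `R X (J X) (J Y) Y` and four of `R X (J Y) (J Y) X`.
    have h1 := hol' (X + Y)
    have h2 := hol' (X + (-1 : ℝ) • Y)
    have h3 := hol' X
    have h4 := hol' Y
    simp only [map_add, map_smul, LinearMap.add_apply, LinearMap.smul_apply, smul_eq_mul,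
      g_symm Y X] at h1 h2
    have e1 : R Y (J Y) (J X) X = R X (J X) (J Y) Y := by
      rw [R_pair, R_swap, R_skew, neg_neg]
    have e2 : R Y (J X) (J X) Y = R X (J Y) (J Y) X := by
      have h := R_J' Y (J X) (J X) Y
      simp only [J_J, map_neg, LinearMap.neg_apply] at h
      linarith [R_swap (J Y) X (J X) Y, R_mixed X (J Y) X Y]
    have e3 := R_mixed X (J Y) X Y
    have e4 := R_mixed Y (J X) Y X
    linarith
  have diff_eq : ∀ X Y, R X Y Y X = R X (J X) (J Y) Y - R X (J Y) (J Y) X := fun X Y ↦ by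
    linarith [bianchi X (J X) (J Y) Y, R_J' X Y X Y, R_skew X Y X Y, R_swap (J Y) X (J X) Y,
      R_mixed X (J Y) X Y]
  have line_eq : ∀ X Y, R X (J X) (J Y) Y
      = c / 2 * (g X Y ^ 2 + g X (J Y) ^ 2 + g X X * g Y Y) := fun X Y ↦ by
    -- Write `A = R X (J X) (J Y) Y` and `B = R X (J Y) (J Y) X`. The identity for `(X, Y)` gives `A
    -- + 2B`; the one for `(X, J Y)` gives `A + 2(A - B)` by `diff_eq`. Their sum is `4A`.
    have h1 := sum_eq X Y
    have h2 := diff_eq X Y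
    have h3 := sum_eq X (J Y)
    have h4 := R_skew X (J X) Y (J Y)
    simp only [J_J, map_neg, LinearMap.neg_apply, g_J] at h3
    linarith
  -- By `R_mixed` the form `R X (J X) (J Y) W` is symmetric in `Y` and `W`, so its quadratic form
  -- determines it.
  have h1 := line_eq X (Y + W)
  have h2 := line_eq X Y
  have h3 := line_eq X W
  have h4 := R_mixed X (J X) Y W
  simp only [map_add, LinearMap.add_apply, g_symm W Y] at h1
  linarith

end CurvatureAlgebra

/-! ### Curvature of an indefinite complex space form. -/

namespace IndefiniteKahler

variable {d : ℕ} {N : Type*} [TopologicalSpace N]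
  [ChartedSpace (EuclideanSpace ℝ (Fin d)) N] [IsManifold (𝓡 d) ∞ N]

/-- The curvature operator `R(X, Y)` on smooth vector fields. -/
def curvatureOperator (K : IndefiniteKahler d N) : SmoothVectorField d N →ₗ[ℝ]
    SmoothVectorField d N →ₗ[ℝ] SmoothVectorField d N →ₗ[ℝ] SmoothVectorField d N :=
  LinearMap.mk₂ ℝ
    (fun X Y ↦ K.cov X ∘ₗ K.cov Y - K.cov Y ∘ₗ K.cov X - K.cov (K.bracket X Y))
    (fun X X' Y ↦ by
      ext1 Z
      simp only [bracket, map_add, map_sub, LinearMap.sub_apply,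
        LinearMap.comp_apply, LinearMap.add_apply]
      abel)
    (fun a X Y ↦ by
      ext1 Z
      simp only [bracket, map_smul, map_sub, LinearMap.sub_apply,
        LinearMap.comp_apply, LinearMap.smul_apply, smul_sub])
    (fun X Y Y' ↦ by
      ext1 Z
      simp only [bracket, map_add, map_sub, LinearMap.sub_apply,
        LinearMap.comp_apply, LinearMap.add_apply]
      abel)
    (fun a X Y ↦ by
      ext1 Z
      simp only [bracket, map_smul, map_sub, LinearMap.sub_apply,
        LinearMap.comp_apply, LinearMap.smul_apply, smul_sub])

theorem curvatureOperator_apply (K : IndefiniteKahler d N) (X Y Z : SmoothVectorField d N) :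
    K.curvatureOperator X Y Z
      = K.cov X (K.cov Y Z) - K.cov Y (K.cov X Z) - K.cov (K.bracket X Y) Z := rfl

theorem curvatureOperator_eq_curvature (K : IndefiniteKahler d N)
    (X Y Z : SmoothVectorField d N) (x : N) :
    K.curvatureOperator X Y Z x = K.curvature X Y Z x := by
  simp only [curvatureOperator_apply, curvature, ContMDiffSection.coe_sub, Pi.sub_apply, cov_apply,
    bracket_apply]
  rfl

/-- The metric at a point, as a bilinear form on smooth vector fields. -/
def metricAt (K : IndefiniteKahler d N) (x : N) :
    SmoothVectorField d N →ₗ[ℝ] SmoothVectorField d N →ₗ[ℝ] ℝ :=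
  LinearMap.mk₂ ℝ (fun X Y ↦ K.g.val x (X x) (Y x)) (by simp) (by simp) (by simp) (by simp)

@[simp]
theorem metricAt_apply (K : IndefiniteKahler d N) (x : N) (X Y : SmoothVectorField d N) :
    K.metricAt x X Y = K.g.val x (X x) (Y x) := rfl

/-- The curvature `g(R(X, Y) Z, W)` at a point, as a quadrilinear form on smooth vector fields. -/
def curvatureForm (K : IndefiniteKahler d N) (x : N) : SmoothVectorField d N →ₗ[ℝ]
    SmoothVectorField d N →ₗ[ℝ] SmoothVectorField d N →ₗ[ℝ] SmoothVectorField d N →ₗ[ℝ] ℝ :=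
  LinearMap.mk₂ ℝ (fun X Y ↦ K.metricAt x ∘ₗ K.curvatureOperator X Y)
    (fun X X' Y ↦ LinearMap.ext fun Z ↦ LinearMap.ext fun W ↦ by simp)
    (fun a X Y ↦ LinearMap.ext fun Z ↦ LinearMap.ext fun W ↦ by simp)
    (fun X Y Y' ↦ LinearMap.ext fun Z ↦ LinearMap.ext fun W ↦ by simp)
    (fun a X Y ↦ LinearMap.ext fun Z ↦ LinearMap.ext fun W ↦ by simp)

@[simp]
theorem curvatureForm_apply (K : IndefiniteKahler d N) (x : N) (X Y Z W : SmoothVectorField d N) :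
    K.curvatureForm x X Y Z W = K.g.val x (K.curvatureOperator X Y Z x) (W x) := rfl

theorem curvatureOperator_swap (K : IndefiniteKahler d N) (X Y Z : SmoothVectorField d N) :
    K.curvatureOperator X Y Z = -K.curvatureOperator Y X Z := by
  simp only [curvatureOperator_apply, bracket, map_sub, LinearMap.sub_apply]
  abel

/-- Since `bracket` is the antisymmetrisation of `cov`, the cyclic sum expands to exactly the Jacobi
expression. -/
theorem curvatureOperator_bianchi (K : IndefiniteKahler d N) (X Y Z : SmoothVectorField d N) :
    K.curvatureOperator X Y Z + K.curvatureOperator Y Z X + K.curvatureOperator Z X Y = 0 := by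
  have h := K.bracket_bracket X Y Z
  rw [← sub_eq_zero] at h
  rw [← h]
  simp only [curvatureOperator_apply, bracket, map_sub, LinearMap.sub_apply]
  abel

theorem cov_complexStructure (K : IndefiniteKahler d N) (X Y : SmoothVectorField d N) :
    K.cov X (K.complexStructure Y) = K.complexStructure (K.cov X Y) := by
  ext x
  exact K.parallel x Y (Y.mdifferentiableAt x) (X x)

theorem curvatureOperator_complexStructure (K : IndefiniteKahler d N)
    (X Y Z : SmoothVectorField d N) :
    K.curvatureOperator X Y (K.complexStructure Z)
      = K.complexStructure (K.curvatureOperator X Y Z) := by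
  simp only [curvatureOperator_apply, cov_complexStructure, map_sub]

theorem mvfderiv_metric (K : IndefiniteKahler d N) (X Y Z : SmoothVectorField d N) (x : N) :
    mvfderiv (𝓡 d) (fun y ↦ K.g.val y (Y y) (Z y)) x (X x)
      = K.g.val x (K.cov X Y x) (Z x) + K.g.val x (Y x) (K.cov X Z x) :=
  K.leviCivita.metric x Y Z (Y.mdifferentiableAt x) (Z.mdifferentiableAt x) (X x)

/-- Differentiate `g(Z,W)` twice. In the commutator of the two derivatives the products of first
derivatives cancel, and comparison with the derivative along `[X,Y]` leaves `g(R(X,Y)Z,W) +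
g(Z,R(X,Y)W) = 0`. -/
theorem curvatureForm_skew [T2Space N] (K : IndefiniteKahler d N) (x : N)
    (X Y Z W : SmoothVectorField d N) :
    K.curvatureForm x X Y Z W = -K.curvatureForm x X Y W Z := by
  have second : ∀ X Y : SmoothVectorField d N,
      mvfderiv (𝓡 d) (fun y ↦ mvfderiv (𝓡 d) (fun z ↦ K.g.val z (Z z) (W z)) y (Y y)) x (X x)
        = K.g.val x (K.cov X (K.cov Y Z) x) (W x) + K.g.val x (K.cov Y Z x) (K.cov X W x)
          + (K.g.val x (K.cov X Z x) (K.cov Y W x) + K.g.val x (Z x) (K.cov X (K.cov Y W) x)) :=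
    fun X Y ↦ by
      simp only [mvfderiv_metric K Y Z W]
      rw [mvfderiv_fun_add ((K.contMDiff_metric _ _ x).mdifferentiableAt (by simp))
        ((K.contMDiff_metric _ _ x).mdifferentiableAt (by simp)), add_apply, mvfderiv_metric,
        mvfderiv_metric]
  have h := K.mvfderiv_bracket X Y (K.contMDiff_metric Z W) x
  rw [second X Y, second Y X, mvfderiv_metric] at h
  simp only [curvatureForm_apply, curvatureOperator_apply, ContMDiffSection.coe_sub,
    Pi.sub_apply, map_sub, sub_apply]
  rw [K.g.symm x _ (Z x), K.g.symm x _ (Z x), K.g.symm x _ (Z x)]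
  linarith

/-- In an indefinite complex space form `N(c)`,
`R(X, JX) JY = (c/2) (g(X,Y) X - g(X,JY) JX + g(X,X) Y)`. -/
theorem curvatureForm_complex_line [T2Space N] (K : IndefiniteKahler d N) {c : ℝ}
    (hK : K.HasConstantHolomorphicSectionalCurvature c) (x : N) (X Y W : SmoothVectorField d N) :
    K.curvatureForm x X (K.complexStructure X) (K.complexStructure Y) W
      = c / 2 * (K.g.val x (X x) (Y x) * K.g.val x (X x) (W x)
        + K.g.val x (X x) (K.J x (Y x)) * K.g.val x (X x) (K.J x (W x))
        + K.g.val x (X x) (X x) * K.g.val x (Y x) (W x)) := by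
  refine kahlerCurvature_apply_complex_line (K.metricAt x) K.complexStructure (K.curvatureForm x) c
    (fun X Y ↦ K.g.symm x _ _) (fun X Y ↦ K.hermitian x _ _) K.complexStructure_complexStructure
    (fun X Y Z W ↦ ?_) (K.curvatureForm_skew x) (fun X Y Z W ↦ ?_) (fun X Y Z W ↦ ?_)
    (fun X hX ↦ ?_) ?_ X Y W
  · rw [curvatureForm_apply, curvatureOperator_swap]; simp
  · have h := congrArg (fun V : SmoothVectorField d N ↦ K.g.val x (V x) (W x))
      (K.curvatureOperator_bianchi X Y Z)
    simpa using h
  · rw [curvatureForm_apply, curvatureOperator_complexStructure]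
    exact K.hermitian x _ _
  · replace hX : K.g.val x (X x) (X x) ≠ 0 := hX
    have h := hK x X (X.contMDiff x) hX
    rw [holomorphicSectionalCurvature, div_eq_iff (pow_ne_zero 2 hX)] at h
    rw [curvatureForm_apply, curvatureOperator_eq_curvature]
    exact h
  · obtain ⟨v, hv⟩ := (K.indefinite x).2
    obtain ⟨X, rfl⟩ := SmoothVectorField.exists_eq v
    exact ⟨X, hv.ne'⟩

end IndefiniteKahler

/-! ### Vector fields along an immersion and their ambient extensions. -/

section AlongMap

variable {d m : ℕ} {N : Type*} [TopologicalSpace N]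
  [ChartedSpace (EuclideanSpace ℝ (Fin d)) N] [IsManifold (𝓡 d) ∞ N]
  {M : Type*} [TopologicalSpace M] [ChartedSpace (EuclideanSpace ℝ (Fin m)) M]

theorem CovariantDerivative.sum
    (nabla : CovariantDerivative (𝓡 d) (EuclideanSpace ℝ (Fin d))
      (TangentSpace (𝓡 d) : N → Type _)) {ι : Type*} (s : Finset ι)
    (σ : ι → Π y : N, TangentSpace (𝓡 d) y) {x : N}
    (hσ : ∀ i ∈ s, MDifferentiableAt (𝓡 d) (𝓡 d).tangent
      (fun y ↦ (⟨y, σ i y⟩ : TangentBundle (𝓡 d) N)) x) :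
    nabla (fun y ↦ ∑ i ∈ s, σ i y) x = ∑ i ∈ s, nabla (σ i) x := by
  classical
  induction s using Finset.induction_on with
  | empty =>
    simp only [Finset.sum_empty]
    exact nabla.isCovariantDerivativeOnUniv.zero (x := x)
  | insert a s ha ih =>
    simp only [Finset.mem_insert, forall_eq_or_imp] at hσ
    simp only [Finset.sum_insert ha, ← ih hσ.2]
    exact nabla.isCovariantDerivativeOnUniv.add hσ.1 (.sum_section hσ.2)

/-- The derivative along `f` of the restriction to `f` of an ambient vector field. -/
theorem covariantDerivAlong_eq
    (nabla : CovariantDerivative (𝓡 d) (EuclideanSpace ℝ (Fin d))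
      (TangentSpace (𝓡 d) : N → Type _))
    {f : M → N} {W : Π q : M, TangentSpace (𝓡 d) (f q)} {p : M} (Z : SmoothVectorField d N)
    (hf : MDifferentiableAt (𝓡 m) (𝓡 d) f p) (hW : ∀ᶠ q in 𝓝 p, W q = Z (f q))
    (u : TangentSpace (𝓡 m) p) :
    covariantDerivAlong nabla f W p u = nabla Z (f p) (mfderiv (𝓡 m) (𝓡 d) f p u) := by
  let t := trivializationAt (EuclideanSpace ℝ (Fin d)) (TangentSpace (𝓡 d) : N → Type _) (f p)
  let b := (EuclideanSpace.basisFun (Fin d) ℝ).toBasis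
  have hp : f p ∈ t.baseSet := FiberBundle.mem_baseSet_trivializationAt' (f p)
  have hframe (i) : MDifferentiableAt (𝓡 d) (𝓡 d).tangent
      (fun y ↦ (⟨y, t.localFrame b i y⟩ : TangentBundle (𝓡 d) N)) (f p) :=
    (contMDiffAt_localFrame_of_mem 1 t b i hp).mdifferentiableAt (by simp)
  let z (i : Fin d) : N → ℝ := fun y ↦ t.localFrameCoeff (𝓡 d) b i y (Z y)
  have hz (i) : MDifferentiableAt (𝓡 d) 𝓘(ℝ) (z i) (f p) :=
    mdifferentiableAt_localFrameCoeff b hp (Z.mdifferentiableAt (f p)) i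
  have hcov : nabla Z (f p) = ∑ i, (z i (f p) • nabla (t.localFrame b i) (f p)
      + (mvfderiv (𝓡 d) (z i) (f p)).smulRight (t.localFrame b i (f p))) := by
    have hsmul (i) : MDifferentiableAt (𝓡 d) (𝓡 d).tangent
        (fun y ↦ (⟨y, z i y • t.localFrame b i y⟩ : TangentBundle (𝓡 d) N)) (f p) :=
      (hz i).smul_section (hframe i)
    have h := nabla.isCovariantDerivativeOnUniv.congr_of_eventuallyEq
      (σ' := fun y ↦ ∑ i, z i y • t.localFrame b i y) (Z.mdifferentiableAt (f p))
      (.sum_section fun i _ ↦ hsmul i) Filter.univ_mem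
      (t.eventually_eq_localFrame_sum_coeff_smul (I := 𝓡 d) b hp)
    rw [h]
    refine (nabla.sum _ (fun i y ↦ z i y • t.localFrame b i y) fun i _ ↦ hsmul i).trans ?_
    exact Finset.sum_congr rfl fun i _ ↦
      nabla.isCovariantDerivativeOnUniv.leibniz (hframe i) (hz i)
  rw [hcov, sum_apply]
  refine Finset.sum_congr rfl fun i _ ↦ ?_
  have hWp := hW.self_of_nhds
  -- Near `p` the frame coefficients of `W` are those of `Z` composed with `f`, so the chain rule
  -- matches the two Leibniz expansions term by term.
  have hder : mvfderiv (𝓡 m) (fun q ↦ t.localFrameCoeff (𝓡 d) b i (f q) (W q)) p u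
      = mvfderiv (𝓡 d) (z i) (f p) (mfderiv (𝓡 m) (𝓡 d) f p u) := by
    rw [← mvfderiv_comp_apply p (hz i) hf]
    have heq : (fun q ↦ t.localFrameCoeff (𝓡 d) b i (f q) (W q)) =ᶠ[𝓝 p] z i ∘ f :=
      hW.mono fun q hq ↦ by simp only [hq, z, Function.comp_apply]
    have := heq.mfderiv_eq (I := 𝓡 m) (I' := 𝓘(ℝ))
    exact DFunLike.congr_fun this u
  simp only [add_apply, smul_apply, ContinuousLinearMap.smulRight_apply]
  rw [hder, hWp, add_comm]

/-- An immersion has a smooth local left inverse. -/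
theorem Manifold.IsImmersion.exists_leftInverse {f : M → N}
    (hf : Manifold.IsImmersion (𝓡 m) (𝓡 d) ∞ f) (p : M) :
    ∃ (V : Set N) (ρ : N → M), IsOpen V ∧ f p ∈ V ∧ ContMDiffOn (𝓡 d) (𝓡 m) ∞ ρ V ∧
      ∀ᶠ q in 𝓝 p, ρ (f q) = q := by
  have h := hf.isImmersionAt p
  let φ := h.domChart
  let ψ := h.codChart
  -- In the immersion charts `f` is the inclusion of the first factor of a product; `pr` is the
  -- projection back onto it.
  let pr : EuclideanSpace ℝ (Fin d) → EuclideanSpace ℝ (Fin m) := fun y ↦ (h.equiv.symm y).1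
  have hpr : ContMDiff (𝓡 d) (𝓡 m) ∞ pr := by
    have : ContDiff ℝ ∞ pr := contDiff_fst.comp h.equiv.symm.contDiff
    exact this.contMDiff
  have hfφ : ∀ q ∈ φ.source, pr (ψ (f q)) = φ q := fun q hq ↦ by
    have hmem : φ q ∈ (φ.extend (𝓡 m)).target := by simpa using φ.map_source hq
    have h1 := h.writtenInCharts hmem
    simp only [Function.comp_apply, OpenPartialHomeomorph.extend_coe,
      OpenPartialHomeomorph.extend_coe_symm, modelWithCornersSelf_coe,
      modelWithCornersSelf_coe_symm, id_eq] at h1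
    rw [φ.left_inv hq] at h1
    simp only [pr, ψ]
    rw [h1, ContinuousLinearEquiv.symm_apply_apply]
  refine ⟨ψ.source ∩ ψ ⁻¹' (pr ⁻¹' φ.target), fun y ↦ φ.symm (pr (ψ y)),
    ψ.isOpen_inter_preimage (hpr.continuous.isOpen_preimage _ φ.open_target),
    ⟨h.mem_codChart_source, ?_⟩, ?_, ?_⟩
  · simp only [Set.mem_preimage]
    rw [hfφ p h.mem_domChart_source]
    exact φ.map_source h.mem_domChart_source
  · exact (contMDiffOn_symm_of_mem_maximalAtlas h.domChart_mem_maximalAtlas).comp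
      (hpr.comp_contMDiffOn ((contMDiffOn_of_mem_maximalAtlas h.codChart_mem_maximalAtlas).mono
        Set.inter_subset_left)) fun y hy ↦ hy.2
  · filter_upwards [φ.open_source.mem_nhds h.mem_domChart_source] with q hq
    rw [hfφ q hq, φ.left_inv hq]

/-- A smooth vector field along an immersion extends locally to an ambient smooth vector field. -/
theorem Manifold.IsImmersion.exists_extension [T2Space N] {f : M → N}
    (hf : Manifold.IsImmersion (𝓡 m) (𝓡 d) ∞ f) {p : M} {U : Set M} (hU : IsOpen U) (hp : p ∈ U)
    {W : Π q : M, TangentSpace (𝓡 d) (f q)}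
    (hW : ContMDiffOn (𝓡 m) (𝓡 d).tangent ∞
      (fun q ↦ (⟨f q, W q⟩ : TangentBundle (𝓡 d) N)) U) :
    ∃ Z : SmoothVectorField d N, ∀ᶠ q in 𝓝 p, Z (f q) = W q := by
  obtain ⟨V, ρ, hV, hpV, hρ, hρf⟩ := hf.exists_leftInverse p
  let t := trivializationAt (EuclideanSpace ℝ (Fin d)) (TangentSpace (𝓡 d) : N → Type _) (f p)
  have hpt : f p ∈ t.baseSet := FiberBundle.mem_baseSet_trivializationAt' (f p)
  have hfc : Continuous f := hf.contMDiff.continuous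
  let U' : Set M := U ∩ f ⁻¹' t.baseSet
  have hU' : IsOpen U' := hU.inter (t.open_baseSet.preimage hfc)
  let w : M → EuclideanSpace ℝ (Fin d) := fun q ↦ (t ⟨f q, W q⟩).2
  have hw : ContMDiffOn (𝓡 m) 𝓘(ℝ, EuclideanSpace ℝ (Fin d)) ∞ w U' :=
    ((t.contMDiffOn_iff (fun q hq ↦ t.mem_source.2 hq.2)).1 (hW.mono Set.inter_subset_left)).2
  let O : Set N := (V ∩ ρ ⁻¹' U') ∩ t.baseSet
  have hO : IsOpen O := (hρ.continuousOn.isOpen_inter_preimage hV hU').inter t.open_baseSet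
  have hpO : f p ∈ O := ⟨⟨hpV, by
    rw [Set.mem_preimage, hρf.self_of_nhds]; exact ⟨hp, hpt⟩⟩, hpt⟩
  -- In the trivialisation, the extension is constant along the fibres of the local retraction `ρ`;
  -- since `ρ (f q) = q` near `p`, it restricts to `W`.
  let s : Π y : N, TangentSpace (𝓡 d) y := fun y ↦ t.symm y (w (ρ y))
  have hs : ContMDiffOn (𝓡 d) (𝓡 d).tangent ∞
      (fun y ↦ (⟨y, s y⟩ : TangentBundle (𝓡 d) N)) O := by
    refine (t.contMDiffOn_section_iff hO Set.inter_subset_right).2 ?_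
    refine (hw.comp (hρ.mono fun y hy ↦ hy.1.1) fun y hy ↦ hy.1.2).congr fun y hy ↦ ?_
    simp only [s, Function.comp_apply]
    rw [t.apply_mk_symm hy.2]
  obtain ⟨Z, hZ⟩ := SmoothVectorField.exists_eventuallyEq hO hpO hs
  refine ⟨Z, ?_⟩
  filter_upwards [hfc.continuousAt.eventually hZ, hρf,
    hfc.continuousAt.eventually (t.open_baseSet.mem_nhds hpt)] with q h1 h2 h3
  rw [h1]
  simp only [s, w]
  rw [h2]
  exact t.symm_apply_apply_mk h3 (W q)

/-- Extend each member of a local frame of `D` and combine the extensions with the constant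
coefficients of `v`: near `p` the result stays in `D`. -/
theorem SubbundleAlong.exists_extension [T2Space N] {f : M → N}
    (hf : Manifold.IsImmersion (𝓡 m) (𝓡 d) ∞ f) (D : SubbundleAlong (d := d) m f) {p : M}
    {v : TangentSpace (𝓡 d) (f p)} (hv : v ∈ D.fiber p) :
    ∃ Z : SmoothVectorField d N, Z (f p) = v ∧ ∀ᶠ q in 𝓝 p, Z (f q) ∈ D.fiber q := by
  obtain ⟨U, hU, hp, s, hs, hspan⟩ := D.exists_localFrame p
  choose S hS using fun i ↦ hf.exists_extension hU hp (hs i)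
  rw [← (hspan p hp).2, Submodule.mem_span_range_iff_exists_fun] at hv
  obtain ⟨c, rfl⟩ := hv
  have happ (y : N) : (∑ i, c i • S i : SmoothVectorField d N) y = ∑ i, c i • S i y := by
    have := map_sum (ContMDiffSection.coeAddHom (𝓡 d) (EuclideanSpace ℝ (Fin d)) ∞
      (TangentSpace (𝓡 d) : N → Type _)) (fun i ↦ c i • S i) Finset.univ
    have h2 := congrFun this y
    rw [Finset.sum_apply] at h2
    exact h2
  refine ⟨∑ i, c i • S i, ?_, ?_⟩
  · rw [happ]
    exact Finset.sum_congr rfl fun i _ ↦ by rw [(hS i).self_of_nhds]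
  · filter_upwards [Filter.eventually_all.2 hS, hU.mem_nhds hp] with q hq hqU
    rw [happ, ← (hspan q hqU).2]
    refine Submodule.sum_mem _ fun i _ ↦ Submodule.smul_mem _ _ ?_
    rw [hq i]
    exact Submodule.subset_span ⟨i, rfl⟩

/-- Every fibre has dimension `D.rank`, so nonzero subbundles can be compared at one common point.
-/
theorem SubbundleAlong.IsNonzero.fiber_ne_bot {f : M → N} {D : SubbundleAlong (d := d) m f}
    (hD : D.IsNonzero) (p : M) : D.fiber p ≠ ⊥ := by
  have hrank (q : M) : Module.finrank ℝ (D.fiber q) = D.rank := by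
    obtain ⟨U, hU, hq, s, hs, hspan⟩ := D.exists_localFrame q
    rw [← (hspan q hq).2, finrank_span_eq_card (hspan q hq).1, Fintype.card_fin]
  have hfin (q : M) : FiniteDimensional ℝ (TangentSpace (𝓡 d) (f q)) :=
    inferInstanceAs (FiniteDimensional ℝ (EuclideanSpace ℝ (Fin d)))
  obtain ⟨q, hq⟩ := hD
  intro h
  apply hq
  have := hfin q
  have := hfin p
  rw [← Submodule.finrank_eq_zero, hrank q, ← hrank p, h, finrank_bot]

end AlongMap

/-! ### Curvature along totally umbilical lightlike submanifolds. -/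

namespace LightlikeSubmanifold

variable {d m : ℕ} {N : Type*} [TopologicalSpace N]
  [ChartedSpace (EuclideanSpace ℝ (Fin d)) N] [IsManifold (𝓡 d) ∞ N]
  {M : Type*} [TopologicalSpace M] [ChartedSpace (EuclideanSpace ℝ (Fin m)) M]
  [IsManifold (𝓡 m) ∞ M]

/-- An ambient vector field which is tangent to an immersed manifold near `p` comes from a smooth
vector field on that manifold. -/
theorem _root_.Manifold.IsImmersion.exists_tangent_lift [T2Space M] {f : M → N}
    (hf : Manifold.IsImmersion (𝓡 m) (𝓡 d) ∞ f) {p : M} {Y : SmoothVectorField d N}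
    (hY : ∀ᶠ q in 𝓝 p, Y (f q) ∈ tangentAlong (m := m) f q) :
    ∃ A : SmoothVectorField m M, ∀ᶠ q in 𝓝 p, mfderiv (𝓡 m) (𝓡 d) f q (A q) = Y (f q) := by
  obtain ⟨V, ρ, hV, hpV, hρ, hρf⟩ := hf.exists_leftInverse p
  have hfs : ContMDiff (𝓡 m) (𝓡 d) ∞ f := hf.contMDiff
  -- The lift is `dρ(Y ∘ f)`: if `Y (f q) = df(v)`, then `dρ(df(v)) = v`, because `ρ ∘ f` is the
  -- identity near `q`.
  let A : Π q : M, TangentSpace (𝓡 m) q := fun q ↦ mfderivWithin (𝓡 d) (𝓡 m) ρ V (f q) (Y (f q))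
  obtain ⟨U, hUρ, hU, hpU⟩ := eventually_nhds_iff.1 hρf
  let O : Set M := U ∩ f ⁻¹' V
  have hO : IsOpen O := hU.inter (hV.preimage hfs.continuous)
  have hA : ContMDiffOn (𝓡 m) (𝓡 m).tangent ∞
      (fun q ↦ (⟨q, A q⟩ : TangentBundle (𝓡 m) M)) O := by
    have h1 := hρ.contMDiffOn_tangentMapWithin (m := ∞) le_rfl hV.uniqueMDiffOn
    have h2 : ContMDiffOn (𝓡 m) (𝓡 m).tangent ∞
        (fun q ↦ tangentMapWithin (𝓡 d) (𝓡 m) ρ V ⟨f q, Y (f q)⟩) O :=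
      h1.comp (Y.contMDiff.comp hfs).contMDiffOn fun q hq ↦ hq.2
    refine h2.congr fun q hq ↦ ?_
    have h3 : ρ (f q) = q := hUρ q hq.1
    have mk_congr : ∀ {a b : M} (w : EuclideanSpace ℝ (Fin m)), a = b →
        (⟨a, w⟩ : TangentBundle (𝓡 m) M) = ⟨b, w⟩ := fun w h ↦ by rw [h]
    exact mk_congr (A q) h3.symm
  obtain ⟨B, hB⟩ := SmoothVectorField.exists_eventuallyEq hO (x := p) ⟨hpU, hpV⟩ hA
  refine ⟨B, ?_⟩
  filter_upwards [hB, hY, hO.mem_nhds ⟨hpU, hpV⟩] with q h1 h2 h3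
  obtain ⟨v, hv⟩ := h2
  rw [h1]
  have hv' : mfderiv (𝓡 m) (𝓡 d) f q v = Y (f q) := hv
  have hid : mfderivWithin (𝓡 d) (𝓡 m) ρ V (f q) (mfderiv (𝓡 m) (𝓡 d) f q v) = v := by
    rw [mfderivWithin_of_isOpen hV h3.2]
    have hd : MDifferentiableAt (𝓡 d) (𝓡 m) ρ (f q) :=
      ((hρ _ h3.2).contMDiffAt (hV.mem_nhds h3.2)).mdifferentiableAt (by simp)
    have h4 := mfderiv_comp_apply q hd ((hfs q).mdifferentiableAt (by simp)) v
    have h5 : ρ ∘ f =ᶠ[𝓝 q] id := by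
      filter_upwards [hU.mem_nhds h3.1] with y hy using hUρ y hy
    have h6 := h5.mfderiv_eq (I := 𝓡 m) (I' := 𝓡 m)
    rw [mfderiv_id] at h6
    exact h4.symm.trans (DFunLike.congr_fun h6 v)
  have hAv : A q = v := by
    simp only [A]
    rw [← hv']
    exact hid
  rw [hAv, hv']

variable {K : IndefiniteKahler d N} {f : M → N}

/-- `∇_u Y - g(u, Y) H` is tangent for every tangent vector field `Y`. -/
theorem nabla_sub_mem_tangentAlong [T2Space M] (L : LightlikeSubmanifold m K.g f)
    {H : Π p : M, TangentSpace (𝓡 d) (f p)}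
    (hH : ∀ X Y : Π p : M, TangentSpace (𝓡 m) p,
      ContMDiff (𝓡 m) (𝓡 m).tangent ∞ (fun p ↦ (⟨p, X p⟩ : TangentBundle (𝓡 m) M)) →
      ContMDiff (𝓡 m) (𝓡 m).tangent ∞ (fun p ↦ (⟨p, Y p⟩ : TangentBundle (𝓡 m) M)) →
      ∀ p, L.secondFundamentalForm K.nabla X Y p = K.g.val (f p)
        (mfderiv (𝓡 m) (𝓡 d) f p (X p)) (mfderiv (𝓡 m) (𝓡 d) f p (Y p)) • H p)
    {p : M} {Y : SmoothVectorField d N}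
    (hY : ∀ᶠ q in 𝓝 p, Y (f q) ∈ tangentAlong (m := m) f q)
    {u : TangentSpace (𝓡 d) (f p)} (hu : u ∈ tangentAlong (m := m) f p) :
    K.nabla Y (f p) u - K.g.val (f p) u (Y (f p)) • H p ∈ tangentAlong (m := m) f p := by
  obtain ⟨u, rfl⟩ := hu
  obtain ⟨X, rfl⟩ := SmoothVectorField.exists_eq u
  obtain ⟨A, hA⟩ := L.isImmersion.exists_tangent_lift hY
  have h := hH X A X.contMDiff A.contMDiff p
  rw [secondFundamentalForm, covariantDerivAlong_eq K.nabla Y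
    ((L.isImmersion.contMDiff p).mdifferentiableAt (by simp)) hA, hA.self_of_nhds] at h
  have h2 := Submodule.projection_apply_mem (L.isCompl_tangent_tr p)
    (K.nabla Y (f p) (mfderiv (𝓡 m) (𝓡 d) f p (X p)))
  rw [Submodule.projection_eq_self_sub_projection (L.isCompl_tangent_tr p).symm, h] at h2
  exact h2

/-- If `M` is totally umbilical, then `R(X, Y) ξ` is tangent to `M` for tangent `X`, `Y` and
radical `ξ`. -/
theorem curvatureOperator_mem_tangentAlong [T2Space M]
    (L : LightlikeSubmanifold m K.g f) (hL : L.IsTotallyUmbilical K.nabla) {p : M}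
    {X Y ξ : SmoothVectorField d N}
    (hX : ∀ᶠ q in 𝓝 p, X (f q) ∈ tangentAlong (m := m) f q)
    (hY : ∀ᶠ q in 𝓝 p, Y (f q) ∈ tangentAlong (m := m) f q)
    (hξ : ∀ᶠ q in 𝓝 p, ξ (f q) ∈ radicalAlong (m := m) K.g f q) :
    K.curvatureOperator X Y ξ (f p) ∈ tangentAlong (m := m) f p := by
  obtain ⟨H, -, -, hH⟩ := hL
  have hξT : ∀ᶠ q in 𝓝 p, ξ (f q) ∈ tangentAlong (m := m) f q := hξ.mono fun q hq ↦ hq.1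
  have horth {q : M} {u v : TangentSpace (𝓡 d) (f q)} (hu : u ∈ tangentAlong (m := m) f q)
      (hv : v ∈ radicalAlong (m := m) K.g f q) : K.g.val (f q) u v = 0 := hv.2 u hu
  -- The transversal part of `∇_Z ξ` is `g(Z,ξ) H`, which vanishes for radical `ξ`.
  have cov_radical {Z : SmoothVectorField d N} {q : M}
      (hZ : Z (f q) ∈ tangentAlong (m := m) f q)
      (hq : ∀ᶠ q' in 𝓝 q, ξ (f q') ∈ radicalAlong (m := m) K.g f q') :
      K.cov Z ξ (f q) ∈ tangentAlong (m := m) f q := by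
    have h := L.nabla_sub_mem_tangentAlong hH (hq.mono fun q hq ↦ hq.1) hZ
    rwa [horth hZ hq.self_of_nhds, zero_smul, sub_zero] at h
  -- As `∇_W ξ` is tangent, the transversal part of `∇_Z ∇_W ξ` is `g(Z, ∇_W ξ) H`. Differentiating
  -- `g(Z,ξ) = 0` along `W` turns the coefficient into `-g(∇_W Z, ξ) = -g(W,Z) g(H,ξ)`. No
  -- derivative of `H` enters.
  have cov_cov {Z W : SmoothVectorField d N}
      (hZ : ∀ᶠ q in 𝓝 p, Z (f q) ∈ tangentAlong (m := m) f q)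
      (hW : ∀ᶠ q in 𝓝 p, W (f q) ∈ tangentAlong (m := m) f q) :
      K.cov Z (K.cov W ξ) (f p)
        + (K.g.val (f p) (Z (f p)) (W (f p)) * K.g.val (f p) (H p) (ξ (f p))) • H p
        ∈ tangentAlong (m := m) f p := by
    have h1 : ∀ᶠ q in 𝓝 p, K.cov W ξ (f q) ∈ tangentAlong (m := m) f q := by
      filter_upwards [hW, hξ.eventually_nhds] with q hq hq' using cov_radical hq hq'
    have h2 := L.nabla_sub_mem_tangentAlong hH h1 hZ.self_of_nhds
    have h3 := horth (L.nabla_sub_mem_tangentAlong hH hZ hW.self_of_nhds) hξ.self_of_nhds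
    have h4 := K.mvfderiv_metric W Z ξ (f p)
    have h5 : mvfderiv (𝓡 d) (fun y ↦ K.g.val y (Z y) (ξ y)) (f p) (W (f p)) = 0 := by
      obtain ⟨w, hw⟩ := hW.self_of_nhds
      have hd : MDifferentiableAt (𝓡 d) 𝓘(ℝ) (fun y ↦ K.g.val y (Z y) (ξ y)) (f p) :=
        (K.contMDiff_metric Z ξ (f p)).mdifferentiableAt (by simp)
      have h6 := mvfderiv_comp_apply p hd
        ((L.isImmersion.contMDiff p).mdifferentiableAt (by simp)) w
      have h7 : (fun y ↦ K.g.val y (Z y) (ξ y)) ∘ f =ᶠ[𝓝 p] fun _ ↦ (0 : ℝ) := by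
        filter_upwards [hZ, hξ] with q h1 h2 using horth h1 h2
      have h8 := h7.mfderiv_eq (I := 𝓡 m) (I' := 𝓘(ℝ))
      rw [mfderiv_const] at h8
      rw [← hw]
      exact h6.symm.trans (DFunLike.congr_fun h8 w)
    simp only [map_sub, map_smul, sub_apply, smul_apply, smul_eq_mul] at h3
    have h9 : K.g.val (f p) (Z (f p)) (K.cov W ξ (f p))
        = -(K.g.val (f p) (Z (f p)) (W (f p)) * K.g.val (f p) (H p) (ξ (f p))) := by
      rw [K.g.symm _ (Z (f p)) (W (f p))]
      rw [IndefiniteKahler.cov_apply] at h4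
      linarith
    rw [h9, neg_smul, sub_neg_eq_add] at h2
    exact h2
  have hbracket : K.bracket X Y (f p) ∈ tangentAlong (m := m) f p := by
    have h1 := L.nabla_sub_mem_tangentAlong hH hY hX.self_of_nhds
    have h2 := L.nabla_sub_mem_tangentAlong hH hX hY.self_of_nhds
    have h3 := Submodule.sub_mem _ h1 h2
    rw [K.g.symm _ (Y (f p)), sub_sub_sub_cancel_right] at h3
    exact h3
  -- The `H`-terms are symmetric in `X` and `Y`, so they cancel in the commutator.
  have h1 := cov_cov hX hY
  have h2 := cov_cov hY hX
  have h3 := Submodule.sub_mem _ h1 h2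
  rw [K.g.symm _ (Y (f p)), add_sub_add_right_eq_sub] at h3
  exact Submodule.sub_mem _ h3 (cov_radical hbracket hξ)

end LightlikeSubmanifold

end

/-! ### The contradiction. -/

theorem theorem4p4 {d m : ℕ}
    {N : Type*} [TopologicalSpace N] [ChartedSpace (EuclideanSpace ℝ (Fin d)) N]
    [IsManifold (𝓡 d) ∞ N] [T2Space N] [ConnectedSpace N]
    {M : Type*} [TopologicalSpace M] [ChartedSpace (EuclideanSpace ℝ (Fin m)) M]
    [IsManifold (𝓡 m) ∞ M] [T2Space M]
    (K : IndefiniteKahler d N) (c : ℝ) (hc : c ≠ 0)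
    (hK : K.HasConstantHolomorphicSectionalCurvature c) :
    ¬ ∃ (f : M → N) (L : LightlikeSubmanifold m K.g f),
      L.IsProperSTCR K ∧ L.IsTotallyUmbilical K.nabla := by
  rintro ⟨f, L, ⟨D, -, hD₂, hD₀, -⟩, hL⟩
  have hscreen (q : M) : L.screen.fiber q ≤ tangentAlong (m := m) f q :=
    le_sup_left.trans (L.screen_sup q).le
  have hD₀T (q : M) : D.D₀.fiber q ≤ tangentAlong (m := m) f q :=
    (le_sup_right.trans (D.screen_sup q).le).trans (hscreen q)
  have hJD₀ {q : M} {v : TangentSpace (𝓡 d) (f q)} (hv : v ∈ D.D₀.fiber q) :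
      K.J (f q) v ∈ D.D₀.fiber q := by
    rw [← D.J_D₀ q]
    exact ⟨v, hv, rfl⟩
  obtain ⟨p, -⟩ := id hD₀
  -- If `g(v,v)` vanished on all of the fibre, polarisation would make `g` vanish there, against
  -- nondegeneracy of `D₀`.
  obtain ⟨v, hv, hvv⟩ : ∃ v ∈ D.D₀.fiber p, K.g.val (f p) v v ≠ 0 := by
    by_contra! hnull
    refine hD₀.fiber_ne_bot p (eq_bot_iff.2 fun v hv ↦ ?_)
    refine Submodule.disjoint_def.1 (D.D₀_nondegenerate p) v hv fun w hw ↦ ?_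
    have h := hnull (v + w) (add_mem hv hw)
    simp only [map_add, add_apply, hnull v hv, hnull w hw] at h
    rw [K.g.symm _ v w] at h
    change K.g.val (f p) w v = 0
    linarith
  obtain ⟨ζ, hζ, hζ0⟩ := Submodule.exists_mem_ne_zero_of_ne_bot (hD₂.fiber_ne_bot p)
  obtain ⟨X, hXp, hX⟩ := D.D₀.exists_extension L.isImmersion hv
  obtain ⟨ξ, hξp, hξ⟩ := D.D₂.exists_extension L.isImmersion hζ
  have hD₂rad (q : M) : D.D₂.fiber q ≤ radicalAlong (m := m) K.g f q :=
    le_sup_right.trans (D.rad_sup q).le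
  have htan := L.curvatureOperator_mem_tangentAlong hL
    (X := X) (Y := K.complexStructure X) (ξ := ξ)
    (hX.mono fun q hq ↦ hD₀T q hq) (hX.mono fun q hq ↦ hD₀T q (hJD₀ hq))
    (hξ.mono fun q hq ↦ hD₂rad q hq)
  have hXξ : K.g.val (f p) v ζ = 0 := (hD₂rad p hζ).2 v (hD₀T p hv)
  have hXJξ : K.g.val (f p) v (K.J (f p) ζ) = 0 := by
    rw [← K.hermitian, K.J_sq, map_neg, neg_eq_zero]
    exact (hD₂rad p hζ).2 _ (hD₀T p (hJD₀ hv))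
  have hR : K.curvatureOperator X (K.complexStructure X) ξ (f p)
      = (-(c / 2 * K.g.val (f p) v v)) • K.J (f p) ζ := by
    rw [← sub_eq_zero]
    refine K.g.nondegenerate (f p) _ fun w ↦ ?_
    obtain ⟨W, rfl⟩ := SmoothVectorField.exists_eq w
    -- The choice `Y = -Jξ` makes `JY = ξ`; only the term `g(X,X) g(Y,W)` survives.
    have h := K.curvatureForm_complex_line hK (f p) X (-K.complexStructure ξ) W
    have hJ : K.complexStructure (-K.complexStructure ξ) = ξ := by
      rw [map_neg, K.complexStructure_complexStructure, neg_neg]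
    rw [hJ, K.curvatureForm_apply] at h
    simp only [ContMDiffSection.coe_neg, Pi.neg_apply, IndefiniteKahler.complexStructure_apply,
      map_neg, neg_apply, K.J_sq, neg_neg, hXp, hξp, hXξ, hXJξ] at h
    simp only [map_sub, map_smul, sub_apply, smul_apply, smul_eq_mul]
    rw [h]
    ring
  rw [hR] at htan
  have hcoef : -(c / 2 * K.g.val (f p) v v) ≠ 0 :=
    neg_ne_zero.2 (mul_ne_zero (div_ne_zero hc two_ne_zero) hvv)
  have hJT := (Submodule.smul_mem_iff _ hcoef).1 htan
  have hJS : K.J (f p) ζ ∈ L.coscreen.fiber p := D.J_D₂_le p ⟨ζ, hζ, rfl⟩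
  have hJN : K.J (f p) ζ ∈ normalAlong (m := m) K.g f p :=
    (le_sup_left.trans (L.coscreen_sup p).le) hJS
  -- `Jζ` is both tangent and normal, hence radical, while `S(TM^⊥)` meets the radical only in zero.
  have hJ0 : K.J (f p) ζ = 0 :=
    Submodule.disjoint_def.1 (L.coscreen_disjoint p) _ hJS ⟨hJT, hJN⟩
  refine hζ0 ?_
  rw [← neg_eq_zero, ← K.J_sq, hJ0, map_zero]
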